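/- Let $q$ be a prime power and $K=\mathbb F_{q^2}$. Let $\mathcal P$ be the set of points $(\alpha,\beta)\in K^2$ with $\beta^{q+1}=\alpha^q+\alpha$ and $\beta\neq 0$, that is, the affine $K$-rational points of the Hermitian curve $y^{q+1}=x^q+x$ with $y\ne 0$. Let $\mathcal H_1=\{(x,y)\mapsto(x+c,y) : c\in K,\ c^q+c=0\}$ and, for a divisor $u\ge 2$ of $q+1$, let $\mathcal H_2=\{(x,y)\mapsto(x,by) : b\in K,\ b^u=1\}$; both groups act on $\mathcal P$. A set $R\subseteq\{1,\dots,n\}\setminus\{i\}$ is a repair set for the coordinate $i$ of a linear code with generator matrix $G=(g_1,\dots,g_n)$ if $g_i$ lies in the span of the $g_\ell$, $\ell\in R$. An $[n,k,\ge d;r_1,r_2]$-recoverable code over $K$ is a $K$-linear code of length $n$, dimension $k$ and minimum distance at least $d$, each coordinate of which has two disjoint repair sets, one of cardinality $r_1$ and one of cardinality $r_2$. 1. For every divisor $u>1$ of $q+1$ and every integer $t_2\ge 0$ with $\frac{2q^2-qu-2}{q(u-1)}\le t_2<\frac{q^2}{u-1}-1$ there exists a $$[\,q(q^2-1),\ q,\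 \ge q(q^2-1)-q(ut_2+u-t_2-2);\ q-1,\ u-1\,]\text{-recoverable code over } K.$$ 2. For all integers $u>1$, $t_2\ge 0$ and $t_1\ge 1$ with $u(t_2+1)=q+1$ and $(t_1,t_2)\ne(1,1)$ there exists a $$[\,q(q^2-1),\ q,\ \ge q(q^2-1)-(q^2-q-2+t_1q);\ q-1,\ u-1\,]\text{-recoverable code over } K.$$ Moreover, in both cases the code can be chosen with its coordinates indexed by the points of $\mathcal P$, in such a way that for every $P\in\mathcal P$ the sets $\mathcal H_1P\setminus\{P\}$ and $\mathcal H_2P\setminus\{P\}$ are disjoint repair sets for the coordinate $P$, of cardinalities $q-1$ and $u-1$. -/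

import Mathlib

namespace HermitianLRC

/-- `G` is a generator matrix of the linear code `C ⊆ K^ι`: its `k` rows form a basis of `C`. -/
def IsGeneratorMatrix {K ι : Type*} [Field K] {k : ℕ}
    (C : Submodule K (ι → K)) (G : Matrix (Fin k) ι K) : Prop :=
  LinearIndependent K (fun a : Fin k => G a) ∧
    Submodule.span K (Set.range fun a : Fin k => G a) = C

/-- `R` is a repair set for the coordinate `i`: it does not contain `i`, and the `i`-th column of
the generator matrix is a linear combination of the columns with index in `R`. -/
def IsRepairSet {K ι : Type*} [Field K] {k : ℕ}
    (G : Matrix (Fin k) ι K) (i : ι) (R : Set ι) : Prop :=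
  i ∉ R ∧ G.col i ∈ Submodule.span K (G.col '' R)

/-- The coordinate `i` has `(r 0, …, r (δ - 1))`-locality: it has pairwise disjoint repair sets
with these cardinalities. -/
def HasLocality {K ι : Type*} [Field K] {k δ : ℕ}
    (G : Matrix (Fin k) ι K) (i : ι) (r : Fin δ → ℕ) : Prop :=
  ∃ R : Fin δ → Set ι,
    (∀ j j', j ≠ j' → Disjoint (R j) (R j')) ∧
    ∀ j, (R j).ncard = r j ∧ IsRepairSet G i (R j)

open Classical in
/-- `C` is an `[n, k, ≥ d; r 0, …, r (δ - 1)]`-recoverable code over `K`, with coordinates indexed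
by the finite type `ι`. The designed distance `d` is an integer, so that no subtraction is
truncated. -/
def IsRecoverableCode {K ι : Type*} [Field K] [Fintype ι] {δ : ℕ}
    (C : Submodule K (ι → K)) (n k : ℕ) (d : ℤ) (r : Fin δ → ℕ) : Prop :=
  Fintype.card ι = n ∧
  (∀ c ∈ C, ∀ c' ∈ C, c ≠ c' → d ≤ (hammingDist c c' : ℤ)) ∧
  ∃ G : Matrix (Fin k) ι K, IsGeneratorMatrix C G ∧ ∀ i, HasLocality G i r

/-- The affine points `(α, β)` over `K` of the Hermitian curve `y^(q+1) = x^q + x` with `β ≠ 0`. -/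
abbrev Point (K : Type*) [Field K] (q : ℕ) : Type _ :=
  {P : K × K // P.2 ^ (q + 1) = P.1 ^ q + P.1 ∧ P.2 ≠ 0}

noncomputable instance {K : Type*} [Field K] [Fintype K] (q : ℕ) : Fintype (Point K q) :=
  Fintype.ofFinite _

/-- The orbit of `P` under the translations `(x, y) ↦ (x + c, y)` with `c^q + c = 0`. -/
def translationOrbit {K : Type*} [Field K] {q : ℕ} (P : Point K q) : Set (Point K q) :=
  {Q | ∃ c : K, c ^ q + c = 0 ∧ Q.1 = (P.1.1 + c, P.1.2)}

/-- The orbit of `P` under the scalings `(x, y) ↦ (x, b y)` with `b^u = 1`. -/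
def scalingOrbit {K : Type*} [Field K] {q : ℕ} (u : ℕ) (P : Point K q) : Set (Point K q) :=
  {Q | ∃ b : K, b ^ u = 1 ∧ Q.1 = (P.1.1, b * P.1.2)}

/-- There is an `[q(q²-1), q, ≥ d; q-1, u-1]`-recoverable code over `K` with coordinates indexed by
the points of the Hermitian curve with `y ≠ 0`, for which the translation orbit and the scaling
orbit of each point, with the point itself removed, are disjoint repair sets of sizes
`q - 1` and `u - 1`. -/
def ExistsHermitianCode (K : Type*) [Field K] [Fintype K] (q u : ℕ) (d : ℤ) : Prop :=
  ∃ C : Submodule K (Point K q → K),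
    IsRecoverableCode C (q * (q ^ 2 - 1)) q d ![q - 1, u - 1] ∧
    ∀ G : Matrix (Fin q) (Point K q) K, IsGeneratorMatrix C G → ∀ P : Point K q,
      Disjoint (translationOrbit P \ {P}) (scalingOrbit u P \ {P}) ∧
      (translationOrbit P \ {P}).ncard = q - 1 ∧
      IsRepairSet G P (translationOrbit P \ {P}) ∧
      (scalingOrbit u P \ {P}).ncard = u - 1 ∧
      IsRepairSet G P (scalingOrbit u P \ {P})

end HermitianLRC

/-! The code consists of the functions `p(x) + c y^m` on the points, with `deg p ≤ q - 2` and `c` a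
scalar: `m = 1` if `u ≠ 2`, and `m = 2` if `u = 2`. On a translation orbit `y` is constant, so a
codeword is a polynomial in `x` of degree below `q - 1`. On a scaling orbit `x` is constant, so it
is affine in `y` with `u - 1 ≥ 2` nodes, or constant if `m = u = 2`. Lagrange interpolation then
repairs (`isRepairSet_of_interpolation`). Zeros are counted by eliminating `y`: with `m e = q + 1`,
a zero with `c ≠ 0` gives `y^m = g(x)`, hence `g(x)^e = x^q + x`. This bounds the zeros by `max ((q
- 2)(q + 1)) (m q)` (`card_zeros_evalMap_le`), which yields both the dimension and the distance. One
code family serves both ranges of parameters. -/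

open Polynomial

namespace HermitianLRC

/-! ### Repair sets from Lagrange interpolation -/

section Interpolation

variable {K ι : Type*} [Field K]

/-- A set of coordinates repairs `i` if on it, and at `i`, every codeword is given by a polynomial
of degree less than its cardinality, evaluated at an injective function of the coordinate. -/
theorem isRepairSet_of_interpolation {k : ℕ} {C : Submodule K (ι → K)} {G : Matrix (Fin k) ι K}
    (hG : IsGeneratorMatrix C G) {i : ι} {R : Set ι} (hR : R.Finite) (hi : i ∉ R) (t : ι → K)
    (ht : Set.InjOn t R)
    (hC : ∀ c ∈ C, ∃ p : K[X], p.degree < R.ncard ∧ p.eval (t i) = c i ∧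
      ∀ j ∈ R, p.eval (t j) = c j) :
    IsRepairSet G i R := by
  classical
  refine ⟨hi, ?_⟩
  have hrow (a : Fin k) : G a ∈ C := hG.2 ▸ Submodule.subset_span ⟨a, rfl⟩
  -- The Lagrange coefficients depend only on the nodes, not on the codeword, so one linear relation
  -- holds in all rows at once.
  have hcol : G.col i =
      ∑ j ∈ hR.toFinset, (Lagrange.basis hR.toFinset t j).eval (t i) • G.col j := by
    ext a
    obtain ⟨p, hp, hpi, hpj⟩ := hC _ (hrow a)
    have h := Lagrange.eq_interpolate_of_eval_eq (s := hR.toFinset) (v := t) (r := G a)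
      (f := p) (by simpa using ht) (by rwa [Set.ncard_eq_toFinset_card R hR] at hp)
      (fun j hj => hpj j (by simpa using hj))
    rw [Matrix.col_apply, ← hpi, h, Lagrange.interpolate_apply, eval_finsetSum,
      Finset.sum_apply]
    exact Finset.sum_congr rfl fun j _ => by
      simp [mul_comm]
  rw [hcol]
  exact Submodule.sum_mem _ fun j hj => Submodule.smul_mem _ _
    (Submodule.subset_span ⟨j, by simpa using hj, rfl⟩)

theorem exists_isGeneratorMatrix [Fintype ι] {k : ℕ} (C : Submodule K (ι → K))
    (hC : Module.finrank K C = k) : ∃ G : Matrix (Fin k) ι K, IsGeneratorMatrix C G := by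
  let b := Module.finBasisOfFinrankEq K C hC
  refine ⟨fun a => (b a : ι → K), ?_, ?_⟩
  · exact b.linearIndependent.map' C.subtype C.ker_subtype
  · have h := congrArg (Submodule.map C.subtype) b.span_eq
    rw [Submodule.map_span, ← Set.range_comp, Submodule.map_top, Submodule.range_subtype] at h
    exact h

end Interpolation

theorem ncard_setOf_pow_eq_le {K : Type*} [Field K] {n : ℕ} (hn : 1 < n) (a : K) :
    {x : K | x ^ n = a * x}.ncard ≤ n := by
  classical
  have hdeg : (C a * X : K[X]).degree < ((n : ℕ) : WithBot ℕ) :=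
    (degree_C_mul_X_le a).trans_lt (by exact_mod_cast hn)
  have hm := monic_X_pow_sub (p := C a * X) hdeg
  have h : {x : K | x ^ n = a * x} ⊆ (X ^ n - C a * X : K[X]).roots.toFinset := by
    intro x hx
    simp only [Set.mem_ofPred_eq] at hx
    simp [hm.ne_zero, hx]
  refine (Set.ncard_le_ncard h (Finset.finite_toSet _)).trans ?_
  rw [Set.ncard_coe_finset]
  refine (Multiset.toFinset_card_le _).trans ((card_roots' _).trans ?_)
  rw [natDegree_sub_eq_left_of_natDegree_lt] <;> rw [natDegree_X_pow]
  exact ((natDegree_C_mul_le a X).trans natDegree_X_le).trans_lt hn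

/-! ### The relative trace and the number of points -/

section PointCount

variable {K : Type*} [Field K] [Fintype K] {q : ℕ}

theorem add_pow_of_card_eq_sq (hq : IsPrimePow q) (hK : Fintype.card K = q ^ 2) (x y : K) :
    (x + y) ^ q = x ^ q + y ^ q := by
  obtain ⟨p, k, hp, -, rfl⟩ := hq
  have : Fact p.Prime := ⟨hp.nat_prime⟩
  have : CharP K p := charP_of_card_eq_prime_pow (f := k * 2) (by rw [hK, pow_mul])
  exact add_pow_char_pow x y p k

/-- The relative trace `x ↦ x^q + x`. -/
def traceHom (hq : IsPrimePow q) (hK : Fintype.card K = q ^ 2) : K →+ K where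
  toFun x := x ^ q + x
  map_zero' := by simp [hq.pos.ne']
  map_add' x y := by rw [add_pow_of_card_eq_sq hq hK]; ring

theorem traceHom_range_subset (hq : IsPrimePow q) (hK : Fintype.card K = q ^ 2) :
    ((traceHom hq hK).range : Set K) ⊆ {x : K | x ^ q = 1 * x} := by
  rintro _ ⟨x, rfl⟩
  have hx : x ^ q ^ 2 = x := hK ▸ FiniteField.pow_card x
  simp only [traceHom, AddMonoidHom.coe_mk, ZeroHom.coe_mk, Set.mem_ofPred_eq, one_mul]
  rw [add_pow_of_card_eq_sq hq hK, ← pow_mul, ← sq, hx, add_comm]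

theorem traceHom_ker_subset (hq : IsPrimePow q) (hK : Fintype.card K = q ^ 2) :
    ((traceHom hq hK).ker : Set K) ⊆ {x : K | x ^ q = (-1) * x} := by
  intro x hx
  have hx : x ^ q + x = 0 := hx
  simp only [Set.mem_ofPred_eq]
  linear_combination hx

/-- Kernel and image lie in root sets of degree-`q` polynomials, so each has at most `q` elements;
their orders multiply to `q^2`, which forces equality. -/
theorem card_traceHom_ker_and_range (hq : IsPrimePow q) (hK : Fintype.card K = q ^ 2) :
    Nat.card (traceHom hq hK).ker = q ∧ Nat.card (traceHom hq hK).range = q := by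
  have hk : Nat.card (traceHom hq hK).ker ≤ q :=
    (Set.ncard_le_ncard (traceHom_ker_subset hq hK) (Set.toFinite _)).trans
      (ncard_setOf_pow_eq_le hq.one_lt _)
  have hr : Nat.card (traceHom hq hK).range ≤ q :=
    (Set.ncard_le_ncard (traceHom_range_subset hq hK) (Set.toFinite _)).trans
      (ncard_setOf_pow_eq_le hq.one_lt _)
  have hmul := (traceHom hq hK).ker.card_mul_index
  rw [AddSubgroup.index_ker, Nat.card_eq_fintype_card (α := K), hK] at hmul
  have := hq.pos
  constructor <;> nlinarith

/-- The trace maps onto the fixed points of `x ↦ x^q`. -/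
theorem exists_pow_add_eq (hq : IsPrimePow q) (hK : Fintype.card K = q ^ 2) {z : K}
    (hz : z ^ q = z) : ∃ x : K, x ^ q + x = z := by
  have h := Set.eq_of_subset_of_ncard_le (traceHom_range_subset hq hK)
    ((ncard_setOf_pow_eq_le hq.one_lt 1).trans
      (card_traceHom_ker_and_range hq hK).2.ge) (Set.toFinite _)
  have : z ∈ ((traceHom hq hK).range : Set K) := by
    rw [h]; simpa using hz
  exact this

/-- The norm `y^(q+1)` is fixed by `x ↦ x^q` because `y^(q^2) = y`. -/
theorem exists_pow_add_eq_norm (hq : IsPrimePow q) (hK : Fintype.card K = q ^ 2) (y : K) :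
    ∃ x : K, x ^ q + x = y ^ (q + 1) := by
  have hy : y ^ q ^ 2 = y := hK ▸ FiniteField.pow_card y
  refine exists_pow_add_eq hq hK ?_
  rw [← pow_mul, show (q + 1) * q = q ^ 2 + q by ring, pow_add, hy, pow_succ']

/-- The points over each `y` form a coset of the kernel of the trace. -/
noncomputable def pointEquiv (hq : IsPrimePow q) (hK : Fintype.card K = q ^ 2) :
    Point K q ≃ (traceHom hq hK).ker × Kˣ where
  toFun P := (⟨P.1.1 - (exists_pow_add_eq_norm hq hK P.1.2).choose, by
    have h := (exists_pow_add_eq_norm hq hK P.1.2).choose_spec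
    rw [AddMonoidHom.mem_ker, map_sub, sub_eq_zero]
    exact P.2.1.symm.trans h.symm⟩, Units.mk0 P.1.2 P.2.2)
  invFun w := ⟨((exists_pow_add_eq_norm hq hK (w.2 : K)).choose + w.1.1, w.2), by
    have h := (exists_pow_add_eq_norm hq hK (w.2 : K)).choose_spec
    have hw : (w.1.1 : K) ^ q + w.1.1 = 0 := w.1.2
    refine ⟨?_, w.2.ne_zero⟩
    simp only
    rw [add_pow_of_card_eq_sq hq hK]
    linear_combination -h - hw⟩
  left_inv P := by ext <;> simp
  right_inv w := by ext <;> simp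

theorem card_point (hq : IsPrimePow q) (hK : Fintype.card K = q ^ 2) :
    Fintype.card (Point K q) = q * (q ^ 2 - 1) := by
  rw [← Nat.card_eq_fintype_card, Nat.card_congr (pointEquiv hq hK), Nat.card_prod,
    (card_traceHom_ker_and_range hq hK).1, Nat.card_units, Nat.card_eq_fintype_card, hK]

theorem card_setOf_pow_eq_one (hK : Fintype.card K = q ^ 2) {u : ℕ} (hu : u ∣ q + 1) :
    {b : K | b ^ u = 1}.ncard = u := by
  have hu0 : u ≠ 0 := by rintro rfl; simp at hu
  have hd : u ∣ Nat.card Kˣ := by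
    rw [Nat.card_units, Nat.card_eq_fintype_card, hK]
    exact hu.trans ⟨q - 1, by simpa using Nat.sq_sub_sq q 1⟩
  have h := IsCyclic.card_powMonoidHom_ker (G := Kˣ) u
  rw [Nat.gcd_eq_right hd] at h
  have himg : {b : K | b ^ u = 1} =
      (fun b : Kˣ => (b : K)) '' ((powMonoidHom u : Kˣ →* Kˣ).ker : Set Kˣ) := by
    ext b
    constructor
    · intro hb
      have hb : b ^ u = 1 := hb
      have hb0 : b ≠ 0 := by rintro rfl; simp [hu0] at hb
      exact ⟨Units.mk0 b hb0, by ext; simpa using hb, rfl⟩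
    · rintro ⟨b, hb, rfl⟩
      have hb : b ^ u = 1 := hb
      simp [← Units.val_pow_eq_pow_val, hb]
  rw [himg, Set.ncard_image_of_injective _ Units.val_injective]
  exact h

end PointCount

/-! ### Sizes and disjointness of the orbits -/

section Orbits

variable {K : Type*} [Field K] {q u : ℕ}

theorem mem_translationOrbit_self (hq : q ≠ 0) (P : Point K q) : P ∈ translationOrbit P :=
  ⟨0, by simp [hq], by simp⟩

theorem mem_scalingOrbit_self (P : Point K q) : P ∈ scalingOrbit u P :=
  ⟨1, by simp, by simp⟩

theorem snd_eq_of_mem_translationOrbit {P Q : Point K q} (h : Q ∈ translationOrbit P) :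
    Q.1.2 = P.1.2 := by
  obtain ⟨c, -, h⟩ := h
  rw [h]

theorem fst_eq_of_mem_scalingOrbit {P Q : Point K q} (h : Q ∈ scalingOrbit u P) :
    Q.1.1 = P.1.1 := by
  obtain ⟨b, -, h⟩ := h
  rw [h]

theorem injOn_fst_translationOrbit (P : Point K q) :
    Set.InjOn (fun Q : Point K q => Q.1.1) (translationOrbit P) := fun _ hQ _ hQ' h =>
  Subtype.ext (Prod.ext h ((snd_eq_of_mem_translationOrbit hQ).trans
    (snd_eq_of_mem_translationOrbit hQ').symm))

theorem injOn_snd_scalingOrbit (P : Point K q) :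
    Set.InjOn (fun Q : Point K q => Q.1.2) (scalingOrbit u P) := fun _ hQ _ hQ' h =>
  Subtype.ext (Prod.ext ((fst_eq_of_mem_scalingOrbit hQ).trans
    (fst_eq_of_mem_scalingOrbit hQ').symm) h)

theorem disjoint_orbits (P : Point K q) :
    Disjoint (translationOrbit P \ {P}) (scalingOrbit u P \ {P}) := by
  rw [Set.disjoint_left]
  rintro Q ⟨h, hne⟩ ⟨h', -⟩
  exact hne (Subtype.ext (Prod.ext (fst_eq_of_mem_scalingOrbit h')
    (snd_eq_of_mem_translationOrbit h)))

theorem ncard_translationOrbit [Fintype K] (hq : IsPrimePow q) (hK : Fintype.card K = q ^ 2)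
    (P : Point K q) : (translationOrbit P).ncard = q := by
  rw [← (injOn_fst_translationOrbit P).ncard_image]
  have himg : (fun Q : Point K q => Q.1.1) '' translationOrbit P =
      (fun c => P.1.1 + c) '' ((traceHom hq hK).ker : Set K) := by
    ext x
    constructor
    · rintro ⟨Q, ⟨c, hc, hQ⟩, rfl⟩
      exact ⟨c, hc, by simp [hQ]⟩
    · rintro ⟨c, hc, rfl⟩
      have hc : c ^ q + c = 0 := hc
      refine ⟨⟨(P.1.1 + c, P.1.2), ?_, P.2.2⟩, ⟨c, hc, rfl⟩, rfl⟩
      simp only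
      rw [add_pow_of_card_eq_sq hq hK]
      linear_combination P.2.1 - hc
  rw [himg, Set.ncard_image_of_injective _ (add_right_injective _)]
  exact (card_traceHom_ker_and_range hq hK).1

theorem ncard_scalingOrbit [Fintype K] (hK : Fintype.card K = q ^ 2) (hu : u ∣ q + 1) (P : Point K q) :
    (scalingOrbit u P).ncard = u := by
  rw [← (injOn_snd_scalingOrbit P).ncard_image]
  have hu0 : u ≠ 0 := by rintro rfl; simp at hu
  have himg : (fun Q : Point K q => Q.1.2) '' scalingOrbit u P =
      (fun b => b * P.1.2) '' {b : K | b ^ u = 1} := by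
    ext x
    constructor
    · rintro ⟨Q, ⟨b, hb, hQ⟩, rfl⟩
      exact ⟨b, hb, by simp [hQ]⟩
    · rintro ⟨b, hb, rfl⟩
      have hb : b ^ u = 1 := hb
      have hb0 : b ≠ 0 := by rintro rfl; simp [hu0] at hb
      refine ⟨⟨(P.1.1, b * P.1.2), ?_, mul_ne_zero hb0 P.2.2⟩, ⟨b, hb, rfl⟩, rfl⟩
      have hb' : b ^ (q + 1) = 1 := by
        obtain ⟨v, hv⟩ := hu
        rw [hv, pow_mul, hb, one_pow]
      simp only
      rw [mul_pow, P.2.1, hb', one_mul]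
  rw [himg, Set.ncard_image_of_injective _ (mul_left_injective₀ P.2.2),
    card_setOf_pow_eq_one hK hu]

end Orbits

/-! ### Zeros of the functions on the curve -/

section Zeros

variable {K : Type*} [Field K] {q : ℕ}

/-- If the `x`-coordinates of a set of points are roots of `A`, and `y^N` is a function of `x` on
it, then it has at most `N * deg A` elements. -/
theorem card_le_mul_natDegree {s : Finset (Point K q)} {A : K[X]} (hA : A ≠ 0)
    (hs : ∀ P ∈ s, A.eval P.1.1 = 0) {N : ℕ} (hN : 0 < N) (z : K → K)
    (hz : ∀ P ∈ s, P.1.2 ^ N = z P.1.1) : s.card ≤ N * A.natDegree := by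
  classical
  have h := Finset.card_le_mul_card_image_of_maps_to (f := fun P : Point K q => P.1.1) (s := s)
    (t := A.roots.toFinset) (fun P hP => by simp [hA, hs P hP]) N (fun x _ => by
      have hle : (s.filter fun P => P.1.1 = x).card ≤ (nthRoots N (z x)).toFinset.card := by
        refine Finset.card_le_card_of_injOn (fun P => P.1.2) ?_ ?_
        · intro P hP
          simp only [Finset.coe_filter, Set.mem_ofPred_eq] at hP
          rw [Finset.mem_coe, Multiset.mem_toFinset, mem_nthRoots hN, hz P hP.1, hP.2]
        · intro P hP Q hQ h
          simp only [Finset.coe_filter, Set.mem_ofPred_eq] at hP hQ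
          exact Subtype.ext (Prod.ext (hP.2.trans hQ.2.symm) h)
      exact hle.trans ((Multiset.toFinset_card_le _).trans (card_nthRoots _ _)))
  exact h.trans (Nat.mul_le_mul_left _ ((Multiset.toFinset_card_le _).trans (card_roots' _)))

/-- The function `p(x) + c y^m` on the curve. -/
def evalMap (K : Type*) [Field K] (q m : ℕ) : (degreeLT K (q - 1) × K) →ₗ[K] (Point K q → K) where
  toFun f P := f.1.1.eval P.1.1 + f.2 * P.1.2 ^ m
  map_add' f g := by ext P; simp; ring
  map_smul' a f := by ext P; simp; ring

theorem evalMap_apply (m : ℕ) (f : degreeLT K (q - 1) × K) (P : Point K q) :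
    evalMap K q m f P = f.1.1.eval P.1.1 + f.2 * P.1.2 ^ m := rfl

theorem natDegree_pow_sub_trace {g : K[X]} {m e : ℕ} (hq : 1 < q) (hme : m * e = q + 1)
    (hmq : m ≤ q) :
    (g ^ e - (X ^ q + X)) ≠ 0 ∧
      m * (g ^ e - (X ^ q + X)).natDegree ≤ max (g.natDegree * (q + 1)) (m * q) := by
  have hdeg : (X ^ q + X : K[X]).natDegree = q := by
    rw [natDegree_add_eq_left_of_natDegree_lt] <;> simp [hq]
  constructor
  · intro h
    have h1 := congrArg natDegree (sub_eq_zero.mp h)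
    rw [natDegree_pow, hdeg] at h1
    -- If the difference vanished, `e` would divide both `q` and `q + 1`, so `e = 1` and `m = q +
    -- 1`, against `m ≤ q`.
    have h2 : e ∣ q := ⟨_, by rw [← h1, mul_comm]⟩
    have h3 : e ∣ 1 := (Nat.dvd_add_right h2).mp ⟨m, by rw [← hme, mul_comm]⟩
    rw [Nat.dvd_one] at h3
    subst h3
    omega
  · have h1 := natDegree_sub_le (g ^ e) (X ^ q + X)
    rw [natDegree_pow, hdeg] at h1
    refine (Nat.mul_le_mul_left m h1).trans ?_
    rw [← Nat.mul_max_mul_left, ← hme]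
    exact max_le_max (by ring_nf; rfl) le_rfl

theorem natDegree_le_of_mem_degreeLT (hq : 1 < q) {p : K[X]} (hp : p ∈ degreeLT K (q - 1)) :
    p.natDegree ≤ q - 2 := by
  by_cases h : p = 0
  · simp [h]
  · have := (natDegree_lt_iff_degree_lt h).mpr (mem_degreeLT.mp hp)
    omega

/-- If `c = 0`, each root of `p` carries at most `q + 1` points. If `c ≠ 0`, the `x`-coordinates are
roots of `g^e - (X^q + X)`, and `y^m = g(x)` leaves at most `m` points over each. -/
theorem card_zeros_evalMap_le (hq : 1 < q) {m : ℕ} (hm : m ∣ q + 1) (hmq : m ≤ q)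
    {f : degreeLT K (q - 1) × K} (hf : f ≠ 0) {s : Finset (Point K q)}
    (hs : ∀ P ∈ s, evalMap K q m f P = 0) : s.card ≤ max ((q - 2) * (q + 1)) (m * q) := by
  obtain ⟨⟨p, hp⟩, c⟩ := f
  have hpdeg := natDegree_le_of_mem_degreeLT hq hp
  obtain ⟨e, hme⟩ := hm
  have hm0 : 0 < m := by
    rcases Nat.eq_zero_or_pos m with rfl | h
    · simp at hme
    · exact h
  simp only [evalMap_apply] at hs
  by_cases hc : c = 0
  · subst hc
    have hp0 : p ≠ 0 := by rintro rfl; exact hf rfl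
    have h := card_le_mul_natDegree hp0 (s := s) (fun P hP => by simpa using hs P hP)
      (Nat.succ_pos q) (fun x => x ^ q + x) (fun P _ => P.2.1)
    refine h.trans (le_max_of_le_left ?_)
    rw [mul_comm]
    exact Nat.mul_le_mul_right _ hpdeg
  · set g : K[X] := C (-c⁻¹) * p with hg
    have hgdeg : g.natDegree ≤ q - 2 := (natDegree_C_mul_le _ _).trans hpdeg
    have hgP (P) (hP : P ∈ s) : P.1.2 ^ m = g.eval P.1.1 := by
      have h := hs P hP
      rw [hg, eval_mul, eval_C]
      field_simp
      linear_combination h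
    obtain ⟨h0, hle⟩ := natDegree_pow_sub_trace (g := g) hq hme.symm hmq
    refine (card_le_mul_natDegree h0 (s := s) (fun P hP => ?_) hm0 (fun x => g.eval x) hgP).trans
      (hle.trans (max_le_max (Nat.mul_le_mul_right _ hgdeg) le_rfl))
    have h : g.eval P.1.1 ^ e = P.1.1 ^ q + P.1.1 := by
      rw [← hgP P hP, ← pow_mul, ← P.2.1]
      exact congrArg (P.1.2 ^ ·) hme.symm
    simp [h]

end Zeros

/-! ### The code: dimension, distance and locality -/

section Code

variable {K : Type*} [Field K] [Fintype K] {q : ℕ}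

/-- A nonzero function has fewer zeros than the `q(q^2 - 1)` available points. -/
theorem evalMap_injective (hq : IsPrimePow q) (hK : Fintype.card K = q ^ 2) {m : ℕ}
    (hm : m ∣ q + 1) (hmq : m ≤ q) : Function.Injective (evalMap K q m) := by
  rw [← LinearMap.ker_eq_bot, LinearMap.ker_eq_bot']
  intro f hf
  by_contra hne
  have h := card_zeros_evalMap_le hq.one_lt hm hmq hne (s := Finset.univ)
    (fun P _ => congrFun hf P)
  rw [Finset.card_univ, card_point hq hK] at h
  obtain ⟨a, rfl⟩ : ∃ a, q = a + 2 := ⟨q - 2, by have := hq.one_lt; omega⟩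
  have h1 : (a + 2) ^ 2 - 1 = a ^ 2 + 4 * a + 3 := by
    have : (a + 2) ^ 2 = a ^ 2 + 4 * a + 3 + 1 := by ring
    omega
  rw [h1, Nat.add_sub_cancel] at h
  rcases le_max_iff.mp h with h | h <;> nlinarith [Nat.mul_le_mul_right (a + 2) hmq]

theorem finrank_range_evalMap (hq : IsPrimePow q) (hK : Fintype.card K = q ^ 2) {m : ℕ}
    (hm : m ∣ q + 1) (hmq : m ≤ q) : Module.finrank K (evalMap K q m).range = q := by
  rw [LinearMap.finrank_range_of_inj (evalMap_injective hq hK hm hmq)]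
  have := hq.one_lt
  have : Module.Finite K (degreeLT K (q - 1)) :=
    Module.Finite.equiv (degreeLTEquiv K (q - 1)).symm
  rw [Module.finrank_prod, (degreeLTEquiv K (q - 1)).finrank_eq, Module.finrank_fin_fun,
    Module.finrank_self]
  omega

open Classical in
theorem le_hammingDist_of_mem_range_evalMap (hq : IsPrimePow q) (hK : Fintype.card K = q ^ 2)
    {m : ℕ} (hm : m ∣ q + 1) (hmq : m ≤ q) {c c' : Point K q → K}
    (hc : c ∈ (evalMap K q m).range) (hc' : c' ∈ (evalMap K q m).range) (hne : c ≠ c') :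
    q * (q ^ 2 - 1) ≤ hammingDist c c' + max ((q - 2) * (q + 1)) (m * q) := by
  obtain ⟨f, rfl⟩ := hc
  obtain ⟨f', rfl⟩ := hc'
  have h := card_zeros_evalMap_le hq.one_lt hm hmq (f := f - f')
    (fun h => hne (by rw [sub_eq_zero.mp h]))
    (s := Finset.univ.filter fun P => ¬ evalMap K q m f P ≠ evalMap K q m f' P)
    (fun P hP => by
      rw [Finset.mem_filter, not_not] at hP
      rw [map_sub, Pi.sub_apply, hP.2, sub_self])
  rw [← card_point hq hK, ← Finset.card_univ,
    ← Finset.card_filter_add_card_filter_not (s := Finset.univ)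
      fun P => evalMap K q m f P ≠ evalMap K q m f' P]
  exact Nat.add_le_add_left h _

theorem isRepairSet_translationOrbit (hq : IsPrimePow q) (hK : Fintype.card K = q ^ 2) {m k : ℕ}
    {G : Matrix (Fin k) (Point K q) K} (hG : IsGeneratorMatrix (evalMap K q m).range G)
    (P : Point K q) : IsRepairSet G P (translationOrbit P \ {P}) := by
  have hcard := Set.ncard_sdiff_singleton_of_mem (mem_translationOrbit_self hq.pos.ne' P)
  rw [ncard_translationOrbit hq hK] at hcard
  refine isRepairSet_of_interpolation hG (Set.toFinite _) (by simp) (fun Q => Q.1.1)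
    ((injOn_fst_translationOrbit P).mono Set.sdiff_subset) ?_
  rintro _ ⟨f, rfl⟩
  refine ⟨f.1.1 + C (f.2 * P.1.2 ^ m), ?_, by simp [evalMap_apply], fun Q hQ => ?_⟩
  · rw [hcard]
    have := hq.one_lt
    refine (degree_add_le _ _).trans_lt (max_lt (mem_degreeLT.mp f.1.2) ?_)
    exact degree_C_le.trans_lt (by exact_mod_cast (by omega : 0 < q - 1))
  · simp [evalMap_apply, snd_eq_of_mem_translationOrbit hQ.1]

theorem isRepairSet_scalingOrbit (hK : Fintype.card K = q ^ 2) {u m k : ℕ} (hu : u ∣ q + 1)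
    (hu1 : 1 < u) (hum : m < u - 1 ∨ m = u) {G : Matrix (Fin k) (Point K q) K}
    (hG : IsGeneratorMatrix (evalMap K q m).range G) (P : Point K q) :
    IsRepairSet G P (scalingOrbit u P \ {P}) := by
  have hcard := Set.ncard_sdiff_singleton_of_mem (mem_scalingOrbit_self (u := u) P)
  rw [ncard_scalingOrbit hK hu] at hcard
  have hpos : (0 : WithBot ℕ) < ((u - 1 : ℕ) : WithBot ℕ) := by
    exact_mod_cast (by omega : 0 < u - 1)
  refine isRepairSet_of_interpolation hG (Set.toFinite _) (by simp) (fun Q => Q.1.2)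
    ((injOn_snd_scalingOrbit P).mono Set.sdiff_subset) ?_
  rintro _ ⟨f, rfl⟩
  rw [hcard]
  rcases hum with hum | rfl
  · refine ⟨C (f.1.1.eval P.1.1) + C f.2 * X ^ m, ?_, by simp [evalMap_apply], fun Q hQ => ?_⟩
    · refine (degree_add_le _ _).trans_lt (max_lt (degree_C_le.trans_lt hpos) ?_)
      exact (degree_C_mul_X_pow_le _ _).trans_lt (by exact_mod_cast hum)
    · simp [evalMap_apply, fst_eq_of_mem_scalingOrbit hQ.1]
  -- Here `b^u = 1` makes `y^m` constant on the orbit, so a constant interpolates even from a single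
  -- node.
  · refine ⟨C (evalMap K q m f P), degree_C_le.trans_lt hpos, by simp, fun Q hQ => ?_⟩
    obtain ⟨b, hb, hQ⟩ := hQ.1
    simp [evalMap_apply, hQ, mul_pow, hb]

theorem existsHermitianCode_of_le (hq : IsPrimePow q) (hK : Fintype.card K = q ^ 2) {u m : ℕ}
    (hu : u ∣ q + 1) (hu1 : 1 < u) (hm : m ∣ q + 1) (hmq : m ≤ q) (hum : m < u - 1 ∨ m = u)
    {D : ℤ} (hD : ((q : ℤ) - 2) * (q + 1) ≤ D) (hD' : (m : ℤ) * q ≤ D) :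
    ExistsHermitianCode K q u ((q : ℤ) * ((q : ℤ) ^ 2 - 1) - D) := by
  have hT (P : Point K q) : (translationOrbit P \ {P}).ncard = q - 1 := by
    rw [Set.ncard_sdiff_singleton_of_mem (mem_translationOrbit_self hq.pos.ne' P),
      ncard_translationOrbit hq hK]
  have hS (P : Point K q) : (scalingOrbit u P \ {P}).ncard = u - 1 := by
    rw [Set.ncard_sdiff_singleton_of_mem (mem_scalingOrbit_self P), ncard_scalingOrbit hK hu]
  refine ⟨(evalMap K q m).range, ⟨card_point hq hK, ?_, ?_⟩, fun G hG P =>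
    ⟨disjoint_orbits P, hT P, isRepairSet_translationOrbit hq hK hG P, hS P,
      isRepairSet_scalingOrbit hK hu hu1 hum hG P⟩⟩
  · intro c hc c' hc' hne
    have h := le_hammingDist_of_mem_range_evalMap hq hK hm hmq hc hc' hne
    have h2 := hq.two_le
    have h1 : 1 ≤ q ^ 2 := Nat.one_le_pow _ _ hq.pos
    zify [h1, h2] at h
    have hmax := max_le hD hD'
    linarith
  · obtain ⟨G, hG⟩ := exists_isGeneratorMatrix _ (finrank_range_evalMap hq hK hm hmq)
    refine ⟨G, hG, fun P => ⟨![translationOrbit P \ {P}, scalingOrbit u P \ {P}], ?_, ?_⟩⟩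
    · rw [Fin.forall_fin_two]
      simp only [Fin.forall_fin_two]
      simp [disjoint_orbits P, (disjoint_orbits P).symm]
    · rw [Fin.forall_fin_two]
      exact ⟨⟨hT P, isRepairSet_translationOrbit hq hK hG P⟩,
        ⟨hS P, isRepairSet_scalingOrbit hK hu hu1 hum hG P⟩⟩

/-- The exponent of `y` can be taken to be `1` for `u ≠ 2`, and `2` for `u = 2`. -/
theorem existsHermitianCode_of_le_of_dvd (hq : IsPrimePow q) (hK : Fintype.card K = q ^ 2) {u : ℕ}
    (hu : u ∣ q + 1) (hu1 : 1 < u) {D : ℤ} (hD : ((q : ℤ) - 2) * (q + 1) ≤ D) (hqD : q ≤ D)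
    (hD' : 3 ≤ q → 2 * (q : ℤ) ≤ D) :
    ExistsHermitianCode K q u ((q : ℤ) * ((q : ℤ) ^ 2 - 1) - D) := by
  have h2 := hq.two_le
  by_cases hu2 : u = 2
  · subst hu2
    exact existsHermitianCode_of_le (m := 2) hq hK hu hu1 hu h2 (Or.inr rfl) hD
      -- `u = 2` makes `q` odd. The bound `2q ≤ D` is assumed only for `q ≥ 3` because it can fail
      -- at `q = 2`, where `D` may be `2`.
      (by exact_mod_cast hD' (by omega))
  · exact existsHermitianCode_of_le (m := 1) hq hK hu hu1 (one_dvd _) (by omega)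
      (Or.inl (by omega)) hD (by simpa using hqD)

end Code

end HermitianLRC

theorem proposition4p2 (q : ℕ) (hq : IsPrimePow q)
    (K : Type*) [Field K] [Fintype K] (hK : Fintype.card K = q ^ 2) :
    (∀ u t₂ : ℕ, 1 < u → u ∣ q + 1 →
      (2 * (q : ℚ) ^ 2 - q * u - 2) / (q * ((u : ℚ) - 1)) ≤ t₂ →
      (t₂ : ℚ) < (q : ℚ) ^ 2 / ((u : ℚ) - 1) - 1 →
      HermitianLRC.ExistsHermitianCode K q u
        ((q : ℤ) * ((q : ℤ) ^ 2 - 1) - q * ((u : ℤ) * t₂ + u - t₂ - 2))) ∧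
    (∀ u t₁ t₂ : ℕ, 1 < u → u * (t₂ + 1) = q + 1 → 1 ≤ t₁ → (t₁, t₂) ≠ (1, 1) →
      HermitianLRC.ExistsHermitianCode K q u
        ((q : ℤ) * ((q : ℤ) ^ 2 - 1) - ((q : ℤ) ^ 2 - q - 2 + t₁ * q))) := by
  have h2 : (2 : ℤ) ≤ q := by exact_mod_cast hq.two_le
  constructor
  · intro u t₂ hu1 hu ht _
    have hu1Q : (0 : ℚ) < (u : ℚ) - 1 := by
      have : (1 : ℚ) < u := by exact_mod_cast hu1
      linarith
    have hqQ : (0 : ℚ) < q := by exact_mod_cast hq.pos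
    rw [div_le_iff₀ (by positivity)] at ht
    have hZ : 2 * (q : ℤ) ^ 2 - q * u - 2 ≤ t₂ * (q * ((u : ℤ) - 1)) := by exact_mod_cast ht
    -- The subtracted term is `t₂ q (u - 1) + q (u - 2)`; the lower bound on `t₂` cancels the
    -- dependence on `u`.
    have hlow : 2 * (q : ℤ) ^ 2 - 2 * q - 2 ≤ q * ((u : ℤ) * t₂ + u - t₂ - 2) := by
      linarith
    refine HermitianLRC.existsHermitianCode_of_le_of_dvd hq hK hu hu1 ?_ ?_ ?_
    · nlinarith
    · nlinarith
    · intro h3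
      have : (3 : ℤ) ≤ q := by exact_mod_cast h3
      nlinarith
  · intro u t₁ t₂ hu1 hu ht₁ _
    have ht : (q : ℤ) ≤ t₁ * q := by exact_mod_cast Nat.le_mul_of_pos_left q ht₁
    refine HermitianLRC.existsHermitianCode_of_le_of_dvd hq hK ⟨_, hu.symm⟩ hu1 ?_ ?_ ?_
    · linarith
    · nlinarith
    · intro h3
      have : (3 : ℤ) ≤ q := by exact_mod_cast h3
      nlinarith
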